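/- Let $n, k$ be natural numbers with $0 \le k < n-1$, and let $\vec\kappa = \langle \kappa_0 \le \kappa_1 \le \dots \le \kappa_n\rangle$ be a weakly increasing tuple of infinite cardinals. Let $X(\vec\kappa) = \prod_{i\le n} \alpha(\kappa_i)$, where $\alpha(\kappa_i) = \kappa_i \sqcup \{\infty\}$ is the one-point compactification of the discrete space of size $\kappa_i$, and let $X(\vec\kappa)^-$ be the subspace obtained by removing the point $(\infty,\dots,\infty)$. For $A \subseteq \{0,\dots,n\}$ put $$\mathcal D_A = \{\vec x \in X(\vec\kappa) : x_i \ne \infty \text{ for all } i \in A\}, \qquad F_A = \{\vec x \in X(\vec\kappa) : x_i \neq \infty \text{ if and only if } i \in A\}.$$ For $\vec x \in F_A$ and finite sets $\mathcal E_j \subseteq \kappa_j$ ($j \notin A$), put $$\mathcal N_A(\vec x, \vec{\mathcal E}) = \{\vec y \in X(\vec\kappa) : y_i = x_i \text{ for all } i \in A, \text{ and } y_j = \infty \text{ or } y_j \notin \mathcal E_j \text{ for all } j \notin A\}.$$ A $k$-Fubini partition of $X(\vec\kappa)^-$ is a partition $\langle Y_i : i \le n\rangle$ of $X(\vec\kappa)^-$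 into $n+1$ pairwise disjoint, possibly empty, sets such that for every $A \subseteq \{0,\dots,n\}$ with $|A| \ge k+1$: 1. for every $i \le n$ with $i \notin A$, the set $Y_i \cap \mathcal D_A$ is clopen in $\mathcal D_A$; and 2. for every $\vec x \in F_A$ there are finite sets $\mathcal E_j \subseteq \kappa_j$ ($j \notin A$) such that $\mathcal N_A(\vec x, \vec{\mathcal E}) \subseteq \bigcup_{i \in A} Y_i$. Then a $k$-Fubini partition of $X(\vec\kappa)^-$ exists if and only if $\kappa_{n-k} = \aleph_0$; and $\kappa_{n-k} = \aleph_0$ holds if and only if the first $n-k+1$ entries $\kappa_0, \dots, \kappa_{n-k}$ are all $\aleph_0$. -/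

import Mathlib

universe u

namespace CardTuple

/-- A set of cardinality `c`, carried as a type of its own so that it can be given the discrete
topology. -/
def Disc (c : Cardinal.{u}) : Type u := Quotient.out c

instance (c : Cardinal.{u}) : TopologicalSpace (Disc c) := ⊥

instance (c : Cardinal.{u}) : DiscreteTopology (Disc c) := ⟨rfl⟩

theorem mk_disc (c : Cardinal.{u}) : Cardinal.mk (Disc c) = c := Cardinal.mk_out c

/-- `X(κ) = ∏_{i ≤ n} α(κ_i)`, the product (with the product topology) of the one-point
compactifications of the discrete spaces of size `κ_i`. -/
abbrev X {n : ℕ} (κ : Fin (n + 1) → Cardinal.{u}) : Type u :=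
  (i : Fin (n + 1)) → OnePoint (Disc (κ i))

variable {n : ℕ} (κ : Fin (n + 1) → Cardinal.{u})

/-- `X(κ)⁻`: the space `X(κ)` without the point `(∞, …, ∞)`. -/
def XMinus : Set (X κ) := {x | x ≠ fun _ => OnePoint.infty}

/-- `𝒟_A = {x : x_i ≠ ∞ for all i ∈ A}`. -/
def DSet (A : Finset (Fin (n + 1))) : Set (X κ) :=
  {x | ∀ i ∈ A, x i ≠ OnePoint.infty}

/-- The `A`-facet `F_A = {x : x_i ≠ ∞ if and only if i ∈ A}`. -/
def facet (A : Finset (Fin (n + 1))) : Set (X κ) :=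
  {x | ∀ i, x i ≠ OnePoint.infty ↔ i ∈ A}

variable {κ}

/-- The basic open set `𝒩_A(x, E)`: the points that agree with `x` on the coordinates in `A` and
whose other coordinates `y_j` are `∞` or lie outside the finite set `E_j`. The sets `E_j` with
`j ∈ A` play no role. -/
def basicNhd (A : Finset (Fin (n + 1))) (x : X κ) (E : (j : Fin (n + 1)) → Finset (Disc (κ j))) :
    Set (X κ) :=
  {y | (∀ i ∈ A, y i = x i) ∧
    ∀ j, j ∉ A → y j = OnePoint.infty ∨ ∃ d : Disc (κ j), y j = (d : OnePoint (Disc (κ j))) ∧ d ∉ E j}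

variable (κ)

/-- `⟨Y_i : i ≤ n⟩` is a `k`-Fubini partition of `X(κ)⁻` (pieces may be empty). -/
structure IsFubiniPartition (k : ℕ) (Y : Fin (n + 1) → Set (X κ)) : Prop where
  iUnion_eq : ⋃ i, Y i = XMinus κ
  pairwise_disjoint : ∀ i j, i ≠ j → Disjoint (Y i) (Y j)
  /-- For `|A| ≥ k + 1` and `i ∉ A`, the set `Y_i` (that is, its trace) is clopen in `𝒟_A`. -/
  isClopen : ∀ A : Finset (Fin (n + 1)), k + 1 ≤ A.card → ∀ i, i ∉ A →
    IsClopen {x : DSet κ A | (x : X κ) ∈ Y i}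
  /-- For `|A| ≥ k + 1`, every point of `F_A` has a basic neighbourhood inside `⋃_{i ∈ A} Y_i`. -/
  exists_basicNhd : ∀ A : Finset (Fin (n + 1)), k + 1 ≤ A.card → ∀ x ∈ facet κ A,
    ∃ E : (j : Fin (n + 1)) → Finset (Disc (κ j)), basicNhd A x E ⊆ ⋃ i ∈ A, Y i

end CardTuple

/-! Nonexistence: let `U` be the top `k + 1` coordinates, all uncountable, and `S` be `U` with two
more. Dropping a direction from `S` leaves a support of size `k + 2`, and dropping also the index
`e` of the piece containing the point leaves `k + 1`, enough for clopenness of `Y e`; so almost all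
of a line lies in one piece (`exists_line`). Values `w i`, `i ∈ U`, avoiding countably many finite
exceptional sets are chosen in increasing order (`exists_generic`). Condition 2 at the point equal
to `w` on `U` and `∞` elsewhere puts a nearby point with support `S` into some `Y i`, `i ∈ U`.
Replacing the later entries `w m`, largest `m` first, by values from countable sets keeps the point
in `Y i`, until genericity of `w i` forces it into some `Y e` with `e ≠ i`.

Existence: any `k + 1` coordinates include a countable one, so the least label among the countable
coordinates' finite entries selects a piece, and only finitely many labels are smaller. -/

open Function in
/-- A point whose support `B` has at least `k + 2` elements lies in some `Y e` with `e ∈ B`, and `Y e`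
contains almost all of every line through it in a direction outside `B`. -/
theorem CardTuple.IsFubiniPartition.exists_line {n k : ℕ} {κ : Fin (n + 1) → Cardinal.{u}}
    {Y : Fin (n + 1) → Set (CardTuple.X κ)} (hY : CardTuple.IsFubiniPartition κ k Y)
    {B : Finset (Fin (n + 1))} (hB : k + 2 ≤ B.card) {x : CardTuple.X κ}
    (hx : x ∈ CardTuple.facet κ B) {j : Fin (n + 1)} (hj : j ∉ B) :
    ∃ e, e ≠ j ∧ {t : CardTuple.Disc (κ j) | update x j (t : OnePoint _) ∉ Y e}.Finite := by
  obtain ⟨E, hE⟩ := hY.exists_basicNhd B (by omega) x hx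
  have hxE : x ∈ CardTuple.basicNhd B x E :=
    ⟨fun _ _ => rfl, fun l hl => Or.inl (by by_contra h; exact hl ((hx l).1 h))⟩
  obtain ⟨e, heB, hxe⟩ : ∃ e, e ∈ B ∧ x ∈ Y e := by simpa using hE hxE
  have hej : e ≠ j := fun h => hj (h ▸ heB)
  refine ⟨e, hej, ?_⟩
  have hcard : k + 1 ≤ (B.erase e).card := by rw [Finset.card_erase_of_mem heB]; omega
  have hopen := (hY.isClopen (B.erase e) hcard e (Finset.notMem_erase e B)).isOpen
  have hmem : ∀ t : OnePoint (CardTuple.Disc (κ j)),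
      update x j t ∈ CardTuple.DSet κ (B.erase e) := by
    intro t l hl
    have hlB := Finset.mem_of_mem_erase hl
    have hlj : l ≠ j := by rintro rfl; exact hj hlB
    rw [update_of_ne hlj]
    exact (hx l).2 hlB
  have hcont : Continuous fun t : OnePoint (CardTuple.Disc (κ j)) =>
      (⟨update x j t, hmem t⟩ : CardTuple.DSet κ (B.erase e)) :=
    ((continuous_const (y := x)).update j continuous_id).subtype_mk hmem
  have hpre := hopen.preimage hcont
  have hxj : x j = OnePoint.infty := by by_contra h; exact hj ((hx j).1 h)
  have hinf : (OnePoint.infty : OnePoint (CardTuple.Disc (κ j))) ∈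
      (fun t : OnePoint (CardTuple.Disc (κ j)) =>
        (⟨update x j t, hmem t⟩ : CardTuple.DSet κ (B.erase e))) ⁻¹'
        {x | (x : CardTuple.X κ) ∈ Y e} := by
    change update x j OnePoint.infty ∈ Y e
    rwa [← hxj, update_eq_self]
  -- An open set around `∞` has compact, hence finite, complement in the discrete part.
  have hc := (OnePoint.isOpen_def.1 hpre).1 hinf
  exact (isCompact_iff_finite.1 hc).subset fun t ht => ht

open Function in
/-- Generic coordinates can be chosen one after the other: `w i` avoids the exceptional sets of all
lines in direction `i` whose other coordinates come from the countable sets `C l` or from the earlier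
`w l`. -/
theorem CardTuple.IsFubiniPartition.exists_generic {n k : ℕ} {κ : Fin (n + 1) → Cardinal.{u}}
    {Y : Fin (n + 1) → Set (CardTuple.X κ)} (hY : CardTuple.IsFubiniPartition κ k Y)
    {S U : Finset (Fin (n + 1))} (hS : k + 3 ≤ S.card) (hUS : U ⊆ S)
    (hU : ∀ i ∈ U, Cardinal.aleph0 < κ i)
    {C : (i : Fin (n + 1)) → Set (OnePoint (CardTuple.Disc (κ i)))}
    (hC : ∀ i, (C i).Countable) (hCS : ∀ i, ∀ t ∈ C i, t ≠ OnePoint.infty ↔ i ∈ S)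
    {w₀ : CardTuple.X κ} (hw₀ : w₀ ∈ CardTuple.facet κ S) (m : ℕ) :
    ∃ w ∈ CardTuple.facet κ S, ∀ i ∈ U, (i : ℕ) < m → ∀ x : CardTuple.X κ, x i = w i →
      (∀ l, l ≠ i → x l ∈ C l ∨ l < i ∧ x l = w l) →
      ∃ e, e ≠ i ∧ x ∈ Y e ∧
        {t : CardTuple.Disc (κ i) | update x i (t : OnePoint _) ∉ Y e}.Finite := by
  induction m with
  | zero => exact ⟨w₀, hw₀, fun i _ h => absurd h (Nat.not_lt_zero _)⟩
  | succ m ih =>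
    obtain ⟨w, hw, hgen⟩ := ih
    by_cases hm : ∃ i ∈ U, (i : ℕ) = m
    swap
    · refine ⟨w, hw, fun i hi him => hgen i hi ?_⟩
      have : (i : ℕ) ≠ m := fun h => hm ⟨i, hi, h⟩
      omega
    obtain ⟨i, hiU, rfl⟩ := hm
    -- Base points of the lines to be controlled. Admitting every `w l`, not just the earlier ones,
    -- still leaves countably many.
    let P : Set (CardTuple.X κ) :=
      {x | x i = OnePoint.infty ∧ ∀ l, l ≠ i → x l ∈ C l ∨ x l = w l}
    have hP : P.Countable := by
      refine Set.Countable.mono ?_ (Set.countable_univ_pi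
        (s := fun l => C l ∪ {w l, OnePoint.infty})
        fun l => (hC l).union (Set.toFinite _).countable)
      rintro x ⟨hxi, hx⟩ l -
      by_cases h : l = i
      · subst h; simp [hxi]
      · rcases hx l h with h | h <;> simp [h]
    have hline : ∀ x ∈ P, ∃ e, e ≠ i ∧
        {t : CardTuple.Disc (κ i) | update x i (t : OnePoint _) ∉ Y e}.Finite := by
      rintro x ⟨hxi, hx⟩
      refine hY.exists_line (B := S.erase i) ?_ (fun l => ?_) (Finset.notMem_erase i S)
      · rw [Finset.card_erase_of_mem (hUS hiU)]; omega
      · by_cases h : l = i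
        · subst h; simp [hxi]
        · have : x l ≠ OnePoint.infty ↔ l ∈ S := by
            rcases hx l h with h' | h'
            · exact hCS l _ h'
            · rw [h']; exact hw l
          simp [h, this]
    choose! e hei hefin using hline
    have hcount : (⋃ x ∈ P,
        {t : CardTuple.Disc (κ i) | update x i (t : OnePoint _) ∉ Y (e x)}).Countable :=
      hP.biUnion fun x hx => (hefin x hx).countable
    obtain ⟨t, ht⟩ : ∃ t, t ∉ ⋃ x ∈ P,
        {t : CardTuple.Disc (κ i) | update x i (t : OnePoint _) ∉ Y (e x)} := by
      by_contra! h
      have huniv := hcount.mono (fun t _ => h t : Set.univ ⊆ _)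
      have := Cardinal.mk_le_aleph0_iff.2 (Set.countable_univ_iff.1 huniv)
      rw [CardTuple.mk_disc] at this
      exact absurd (hU i hiU) (not_lt.2 this)
    refine ⟨update w i (t : OnePoint _), fun l => ?_, fun j hj hji x hxj hx => ?_⟩
    · by_cases h : l = i
      · subst h; simp [hUS hiU]
      · rw [update_of_ne h]; exact hw l
    · by_cases h : j = i
      · subst h
        rw [update_self] at hxj
        have hup : ∀ s, update (update x j OnePoint.infty) j s = update x j s := fun s => by simp
        have hxP : update x j OnePoint.infty ∈ P := by
          refine ⟨by simp, fun l hl => ?_⟩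
          rw [update_of_ne hl]
          rcases hx l hl with h | ⟨-, h⟩
          · exact Or.inl h
          · rw [update_of_ne hl] at h; exact Or.inr h
        refine ⟨e _, hei _ hxP, ?_, by simpa only [hup] using hefin _ hxP⟩
        by_contra hne
        refine ht (Set.mem_biUnion hxP ?_)
        change update (update x j OnePoint.infty) j (t : OnePoint _) ∉ _
        rwa [hup, ← hxj, update_eq_self]
      · have hlt : (j : ℕ) < i := by
          have : (j : ℕ) ≠ i := fun h' => h (Fin.ext h')
          omega
        rw [update_of_ne h] at hxj
        -- Genericity at `j < i` involves only `w l` with `l ≤ j`, so changing `w` at `i` does not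
        -- affect it.
        refine hgen j hj hlt x hxj fun l hl => ?_
        rcases hx l hl with h' | ⟨hlj, h'⟩
        · exact Or.inl h'
        · have : l ≠ i := by rintro rfl; exact absurd hlj (not_lt.2 (Fin.le_def.2 hlt.le))
          rw [update_of_ne this] at h'
          exact Or.inr ⟨hlj, h'⟩

open Function in
/-- There is no `k`-Fubini partition if `k + 1` of the cardinals are uncountable and there are at
least two further coordinates. -/
theorem CardTuple.IsFubiniPartition.false_of_uncountable {n k : ℕ}
    {κ : Fin (n + 1) → Cardinal.{u}}
    {Y : Fin (n + 1) → Set (CardTuple.X κ)} (hY : CardTuple.IsFubiniPartition κ k Y)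
    (hκ : ∀ i, Cardinal.aleph0 ≤ κ i) {S U : Finset (Fin (n + 1))} (hS : k + 3 ≤ S.card)
    (hUS : U ⊆ S) (hUcard : k + 1 ≤ U.card) (hU : ∀ i ∈ U, Cardinal.aleph0 < κ i) : False := by
  have hinf : ∀ i, Infinite (CardTuple.Disc (κ i)) := fun i => by
    rw [Cardinal.infinite_iff, CardTuple.mk_disc]; exact hκ i
  let N : (i : Fin (n + 1)) → Set (CardTuple.Disc (κ i)) :=
    fun i => Set.range (Infinite.natEmbedding (CardTuple.Disc (κ i)))
  have hN : ∀ i, (N i).Infinite := fun i =>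
    Set.infinite_range_of_injective (Infinite.natEmbedding _).injective
  let C : (i : Fin (n + 1)) → Set (OnePoint (CardTuple.Disc (κ i))) :=
    fun i => if i ∈ S then OnePoint.some '' N i else {OnePoint.infty}
  have hC_mem : ∀ i ∈ S, ∀ t ∈ N i, (t : OnePoint _) ∈ C i := fun i hi t ht => by
    simp only [C, if_pos hi]; exact ⟨t, ht, rfl⟩
  have hC : ∀ i, (C i).Countable := fun i => by
    simp only [C]
    split_ifs
    · exact (Set.countable_range _).image _
    · exact Set.countable_singleton _
  have hCS : ∀ i, ∀ t ∈ C i, t ≠ OnePoint.infty ↔ i ∈ S := fun i t ht => by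
    by_cases hi : i ∈ S
    · simp only [C, if_pos hi] at ht
      obtain ⟨d, -, rfl⟩ := ht
      simp [hi]
    · simp only [C, if_neg hi] at ht
      rw [Set.mem_singleton_iff.1 ht]
      simp [hi]
  have hCne : ∀ i, ∃ t, t ∈ C i := fun i => by
    by_cases hi : i ∈ S
    · obtain ⟨t, ht⟩ := (hN i).nonempty
      exact ⟨t, hC_mem i hi t ht⟩
    · exact ⟨OnePoint.infty, by simp [C, hi]⟩
  choose w₀ hw₀ using hCne
  obtain ⟨w, hw, hgen⟩ := hY.exists_generic hS hUS hU hC hCS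
    (w₀ := w₀) (fun i => hCS i _ (hw₀ i)) (n + 1)
  replace hgen := fun i hi => hgen i hi i.isLt
  let z : CardTuple.X κ := fun i => if i ∈ U then w i else OnePoint.infty
  have hz : z ∈ CardTuple.facet κ U := fun i => by
    by_cases hi : i ∈ U
    · simp only [z, if_pos hi, hi, iff_true]; exact (hw i).2 (hUS hi)
    · simp [z, hi]
  obtain ⟨E, hE⟩ := hY.exists_basicNhd U hUcard z hz
  choose a haN haE using fun i => ((hN i).sdiff (E i).finite_toSet).nonempty
  let x₀ : CardTuple.X κ :=
    fun i => if i ∈ U then w i else if i ∈ S then (a i : OnePoint _) else OnePoint.infty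
  have hx₀ : x₀ ∈ CardTuple.basicNhd U z E := by
    refine ⟨fun i hi => by simp [x₀, z, hi], fun j hj => ?_⟩
    by_cases hjS : j ∈ S
    · exact Or.inr ⟨a j, by simp [x₀, hj, hjS], haE j⟩
    · exact Or.inl (by simp [x₀, hj, hjS])
  obtain ⟨i, hiU, hi⟩ : ∃ i, i ∈ U ∧ x₀ ∈ Y i := by simpa using hE hx₀
  -- After `d` steps, every coordinate `l > i` with `l ≥ n + 1 - d` has its entry in `C l`.
  have hmove : ∀ d : ℕ, ∃ x ∈ Y i, x i = w i ∧
      ∀ l, l ≠ i → x l ∈ C l ∨ (l ∈ U ∧ ((l : ℕ) < n + 1 - d ∨ l < i) ∧ x l = w l) := by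
    intro d
    induction d with
    | zero =>
      refine ⟨x₀, hi, by simp [x₀, hiU], fun l _ => ?_⟩
      by_cases hlU : l ∈ U
      · exact Or.inr ⟨hlU, Or.inl l.isLt, by simp [x₀, hlU]⟩
      · by_cases hlS : l ∈ S
        · exact Or.inl (by simpa [x₀, hlU, hlS] using hC_mem l hlS _ (haN l))
        · exact Or.inl (by simp [x₀, hlU, hlS, C])
    | succ d ih =>
      obtain ⟨x, hxY, hxi, hx⟩ := ih
      by_cases hm : ∃ m : Fin (n + 1), i < m ∧ (m : ℕ) = n + 1 - (d + 1) ∧ x m ∉ C m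
      swap
      · refine ⟨x, hxY, hxi, fun l hl => ?_⟩
        rcases hx l hl with h | ⟨hlU, hlt, h⟩
        · exact Or.inl h
        · by_cases hlC : x l ∈ C l
          · exact Or.inl hlC
          · refine Or.inr ⟨hlU, ?_, h⟩
            by_contra! hcon
            rcases hlt with hlt | hlt
            · exact hm ⟨l, lt_of_le_of_ne hcon.2 hl.symm, by omega, hlC⟩
            · exact absurd hlt (not_lt.2 hcon.2)
      obtain ⟨m, him, hmd, hmC⟩ := hm
      obtain ⟨hmU, -, hxm⟩ := (hx m him.ne').resolve_left hmC
      obtain ⟨e, -, hxe, hfin⟩ := hgen m hmU x hxm (fun l hlm => by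
        by_cases hli : l = i
        · subst hli; exact Or.inr ⟨him, hxi⟩
        · rcases hx l hli with h | ⟨-, hlt, h⟩
          · exact Or.inl h
          · refine Or.inr ⟨?_, h⟩
            rcases hlt with hlt | hlt
            · have : (l : ℕ) ≠ m := fun h' => hlm (Fin.ext h')
              exact Fin.lt_def.2 (by omega)
            · exact hlt.trans him)
      -- The line's piece contains `x ∈ Y i`, so it is `Y i`, and the infinite set `N m` supplies a
      -- replacement that stays in it.
      obtain rfl : e = i := by
        by_contra hne
        exact Set.disjoint_left.1 (hY.pairwise_disjoint e i hne) hxe hxY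
      obtain ⟨t, htN, ht⟩ := ((hN m).sdiff hfin).nonempty
      refine ⟨update x m (t : OnePoint _), by by_contra h; exact ht h, ?_, fun l hl => ?_⟩
      · rw [update_of_ne him.ne]; exact hxi
      · by_cases hlm : l = m
        · subst hlm
          rw [update_self]
          exact Or.inl (hC_mem l (hUS hmU) t htN)
        · rw [update_of_ne hlm]
          rcases hx l hl with h | ⟨hlU, hlt, h⟩
          · exact Or.inl h
          · refine Or.inr ⟨hlU, ?_, h⟩
            rcases hlt with hlt | hlt
            · have : (l : ℕ) ≠ m := fun h' => hlm (Fin.ext h')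
              exact Or.inl (by omega)
            · exact Or.inr hlt
  obtain ⟨x, hxY, hxi, hx⟩ := hmove (n + 1)
  obtain ⟨e, hei, hxe, -⟩ := hgen i hiU x hxi fun l hl => by
    rcases hx l hl with h | ⟨-, hlt, h⟩
    · exact Or.inl h
    · exact Or.inr ⟨hlt.resolve_left (by omega), h⟩
  exact Set.disjoint_left.1 (hY.pairwise_disjoint e i hei) hxe hxY

/-- If all but `k` of the cardinals are countable, a `k`-Fubini partition exists: a point is assigned
to the countable coordinate whose entry comes first in an enumeration of all these entries. -/
theorem CardTuple.exists_isFubiniPartition {n k : ℕ} {κ : Fin (n + 1) → Cardinal.{u}}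
    {B : Finset (Fin (n + 1))} (hB : ∀ i ∈ B, κ i ≤ Cardinal.aleph0)
    (hAB : ∀ A : Finset (Fin (n + 1)), k + 1 ≤ A.card → ∃ i ∈ A, i ∈ B) :
    ∃ Y : Fin (n + 1) → Set (CardTuple.X κ), CardTuple.IsFubiniPartition κ k Y := by
  classical
  have he : ∀ i, ∃ e : CardTuple.Disc (κ i) → ℕ, i ∈ B → Function.Injective e := fun i => by
    by_cases hi : i ∈ B
    · have : Countable (CardTuple.Disc (κ i)) := by
        rw [← Cardinal.mk_le_aleph0_iff, CardTuple.mk_disc]; exact hB i hi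
      obtain ⟨e, he⟩ := exists_injective_nat (CardTuple.Disc (κ i))
      exact ⟨e, fun _ => he⟩
    · exact ⟨fun _ => 0, fun h => absurd h hi⟩
  choose e he using he
  -- Pairing with `i` excludes ties between different coordinates.
  let g : (i : Fin (n + 1)) → CardTuple.Disc (κ i) → ℕ := fun i d => Nat.pair i (e i d)
  have hg : ∀ i ∈ B, Function.Injective (g i) := fun i hi d d' h =>
    he i hi (Nat.pair_eq_pair.1 h).2
  have hgne : ∀ i j d d', g i d = g j d' → i = j := fun i j d d' h =>
    Fin.ext (Nat.pair_eq_pair.1 h).1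
  let Z : Fin (n + 1) → Set (CardTuple.X κ) := fun i =>
    {x | i ∈ B ∧ ∃ d : CardTuple.Disc (κ i), x i = (d : OnePoint _) ∧
      ∀ j ∈ B, ∀ d' : CardTuple.Disc (κ j), x j = (d' : OnePoint _) → g i d ≤ g j d'}
  have hfin : ∀ j ∈ B, ∀ m, {d | g j d < m}.Finite := fun j hj m =>
    (Set.finite_Iio m).preimage (hg j hj).injOn
  have hZdisj : ∀ i j x, x ∈ Z i → x ∈ Z j → i = j := by
    rintro i j x ⟨hi, d, hd, hmin⟩ ⟨hj, d', hd', hmin'⟩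
    exact hgne i j d d' (le_antisymm (hmin j hj d' hd') (hmin' i hi d hd))
  have hZcover : ∀ x : CardTuple.X κ, (∃ i ∈ B, x i ≠ OnePoint.infty) → ∃ i, x ∈ Z i := by
    rintro x ⟨i₀, hi₀, hx⟩
    obtain ⟨d₀, hd₀⟩ := OnePoint.ne_infty_iff_exists.1 hx
    have hex : ∃ m, ∃ i ∈ B, ∃ d : CardTuple.Disc (κ i), x i = (d : OnePoint _) ∧ g i d = m :=
      ⟨_, i₀, hi₀, d₀, hd₀.symm, rfl⟩
    obtain ⟨i, hi, d, hd, hm⟩ := Nat.find_spec hex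
    refine ⟨i, hi, d, hd, fun j hj d' hd' => ?_⟩
    rw [hm]
    exact Nat.find_min' hex ⟨j, hj, d', hd', rfl⟩
  have hZopen : ∀ i, IsOpen (Z i) := by
    intro i
    rw [isOpen_iff_forall_mem_open]
    rintro x ⟨hi, d, hd, hmin⟩
    refine ⟨(fun y : CardTuple.X κ => y i) ⁻¹' {(d : OnePoint _)} ∩
      ⋂ j ∈ B, (fun y : CardTuple.X κ => y j) ⁻¹'
        (OnePoint.some '' {d' | g j d' < g i d})ᶜ, ?_, ?_, ?_⟩
    · rintro y ⟨hyd, hy⟩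
      refine ⟨hi, d, hyd, fun j hj d' hd' => ?_⟩
      by_contra! hlt
      exact Set.mem_iInter₂.1 hy j hj ⟨d', hlt, hd'.symm⟩
    · refine IsOpen.inter (IsOpen.preimage (continuous_apply i) ?_)
        (B.finite_toSet.isOpen_biInter fun j hj => IsOpen.preimage (continuous_apply j) ?_)
      · simpa using OnePoint.isOpenEmbedding_coe.isOpenMap {d} (isOpen_discrete _)
      · exact ((hfin j hj _).image _).isClosed.isOpen_compl
    · refine ⟨hd, Set.mem_iInter₂.2 fun j hj => ?_⟩
      rintro ⟨d', hlt, hd'⟩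
      exact absurd (hmin j hj d' hd'.symm) (not_le.2 hlt)
  -- Leftover points without a label go to piece `0`; this is harmless, since `R` misses every `𝒟_A`
  -- with `|A| ≥ k + 1`.
  let R : Set (CardTuple.X κ) := {x | x ∈ CardTuple.XMinus κ ∧ ∀ i ∈ B, x i = OnePoint.infty}
  have hZR : ∀ i x, x ∈ Z i → x ∉ R := by
    rintro i x ⟨hi, d, hd, -⟩ ⟨-, hR⟩
    exact OnePoint.coe_ne_infty d (hd.symm.trans (hR i hi))
  have hsupp : ∀ A : Finset (Fin (n + 1)), k + 1 ≤ A.card → ∀ x ∈ CardTuple.DSet κ A,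
      ∃ i ∈ B, x i ≠ OnePoint.infty := fun A hA x hx => by
    obtain ⟨i, hiA, hiB⟩ := hAB A hA
    exact ⟨i, hiB, hx i hiA⟩
  refine ⟨fun i => Z i ∪ {x | i = 0 ∧ x ∈ R}, ?_, ?_, ?_, ?_⟩
  · ext x
    rw [Set.mem_iUnion]
    constructor
    · rintro ⟨i, ⟨-, d, hd, -⟩ | ⟨-, hR⟩⟩
      · rintro rfl
        exact OnePoint.infty_ne_coe d hd
      · exact hR.1
    · intro hx
      by_cases h : ∃ i ∈ B, x i ≠ OnePoint.infty
      · obtain ⟨i, hi⟩ := hZcover x h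
        exact ⟨i, Or.inl hi⟩
      · push Not at h
        exact ⟨0, Or.inr ⟨rfl, hx, h⟩⟩
  · intro i j hij
    rw [Set.disjoint_left]
    rintro x (hi | ⟨rfl, hi⟩) (hj | ⟨rfl, hj⟩)
    · exact hij (hZdisj i j x hi hj)
    · exact hZR i x hi hj
    · exact hZR j x hj hi
    · exact hij rfl
  · intro A hA i _
    have hopen : ∀ j, IsOpen {x : CardTuple.DSet κ A | (x : CardTuple.X κ) ∈ Z j} := fun j =>
      (hZopen j).preimage continuous_subtype_val
    have hset : {x : CardTuple.DSet κ A | (x : CardTuple.X κ) ∈ Z i ∪ {x | i = 0 ∧ x ∈ R}} =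
        {x : CardTuple.DSet κ A | (x : CardTuple.X κ) ∈ Z i} := by
      ext x
      refine ⟨fun h => h.resolve_right fun hR => ?_, Or.inl⟩
      obtain ⟨j, hj, hne⟩ := hsupp A hA x x.2
      exact hne (hR.2.2 j hj)
    -- On `𝒟_A` the open sets `Z j` form a partition, so each of them is also closed.
    have hcompl : {x : CardTuple.DSet κ A | (x : CardTuple.X κ) ∈ Z i}ᶜ =
        ⋃ j, ⋃ _ : j ≠ i, {x : CardTuple.DSet κ A | (x : CardTuple.X κ) ∈ Z j} := by
      ext x
      simp only [Set.mem_compl_iff, Set.mem_iUnion, Set.mem_ofPred_eq]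
      constructor
      · intro hx
        obtain ⟨j, hj⟩ := hZcover x (hsupp A hA x x.2)
        exact ⟨j, fun h => hx (h ▸ hj), hj⟩
      · rintro ⟨j, hji, hj⟩ hi
        exact hji (hZdisj j i x hj hi)
    rw [hset]
    refine ⟨⟨?_⟩, hopen i⟩
    rw [hcompl]
    exact isOpen_iUnion fun j => isOpen_iUnion fun _ => hopen j
  · intro A hA x hx
    obtain ⟨i, hi, d, hd, hmin⟩ := hZcover x (hsupp A hA x fun j hj => (hx j).2 hj)
    have hiA : i ∈ A := (hx i).1 (by rw [hd]; exact OnePoint.coe_ne_infty d)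
    refine ⟨fun j => if hj : j ∈ B then (hfin j hj (g i d)).toFinset else ∅, ?_⟩
    rintro y ⟨hyA, hyE⟩
    refine Set.mem_biUnion hiA (Or.inl ⟨hi, d, (hyA i hiA).trans hd, fun j hj d' hd' => ?_⟩)
    by_cases hjA : j ∈ A
    · exact hmin j hj d' ((hyA j hjA).symm.trans hd')
    · rcases hyE j hjA with h | ⟨c, hc, hcE⟩
      · exact absurd (hd'.symm.trans h) (OnePoint.coe_ne_infty d')
      · obtain rfl : d' = c := OnePoint.coe_injective (hd'.symm.trans hc)
        simpa [hj] using hcE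

theorem mainTheorem5 (n k : ℕ) (hk : k + 1 < n) (κ : Fin (n + 1) → Cardinal.{u})
    (hκ : ∀ i, Cardinal.aleph0 ≤ κ i) (hmono : Monotone κ) :
    ((∃ Y : Fin (n + 1) → Set (CardTuple.X κ), CardTuple.IsFubiniPartition κ k Y) ↔
        κ ⟨n - k, Nat.lt_succ_of_le (Nat.sub_le n k)⟩ = Cardinal.aleph0) ∧
      (κ ⟨n - k, Nat.lt_succ_of_le (Nat.sub_le n k)⟩ = Cardinal.aleph0 ↔
        ∀ i : Fin (n + 1), (i : ℕ) < n - k + 1 → κ i = Cardinal.aleph0) := by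
  set p : Fin (n + 1) := ⟨n - k, Nat.lt_succ_of_le (Nat.sub_le n k)⟩ with hp
  have hpv : (p : ℕ) = n - k := rfl
  refine ⟨⟨?_, fun h => ?_⟩, fun h i hi => ?_, fun h => h p (Nat.lt_succ_self _)⟩
  · rintro ⟨Y, hY⟩
    by_contra hne
    have hlt : Cardinal.aleph0 < κ p := lt_of_le_of_ne (hκ p) (Ne.symm hne)
    have hUcard : (Finset.Ici p).card = k + 1 := by rw [Fin.card_Ici]; omega
    -- Since `k + 1 < n`, `p ≥ 2`: coordinates `0` and `1` are the two extra ones.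
    have h0 : (⟨0, by omega⟩ : Fin (n + 1)) ∉
        insert (⟨1, by omega⟩ : Fin (n + 1)) (Finset.Ici p) := by
      simp only [Finset.mem_insert, Finset.mem_Ici, Fin.le_def, Fin.mk.injEq]
      omega
    have h1 : (⟨1, by omega⟩ : Fin (n + 1)) ∉ Finset.Ici p := by
      simp only [Finset.mem_Ici, Fin.le_def]
      omega
    refine hY.false_of_uncountable hκ (U := Finset.Ici p)
      (S := insert ⟨0, by omega⟩ (insert ⟨1, by omega⟩ (Finset.Ici p))) ?_ ?_ hUcard.ge
      fun i hi => hlt.trans_le (hmono (Finset.mem_Ici.1 hi))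
    · rw [Finset.card_insert_of_notMem h0, Finset.card_insert_of_notMem h1, hUcard]
    · exact (Finset.subset_insert _ _).trans (Finset.subset_insert _ _)
  · refine CardTuple.exists_isFubiniPartition (B := Finset.Iic p)
      (fun i hi => (hmono (Finset.mem_Iic.1 hi)).trans h.le) fun A hA => ?_
    by_contra! hcon
    have hsub : A ⊆ Finset.Ioi p := fun i hi =>
      Finset.mem_Ioi.2 (not_le.1 fun hle => hcon i hi (Finset.mem_Iic.2 hle))
    have := Finset.card_le_card hsub
    rw [Fin.card_Ioi] at this
    omega
  · have hip : i ≤ p := Fin.le_def.2 (by omega)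
    exact le_antisymm ((hmono hip).trans h.le) (hκ i)
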